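/- Let $A\in\mathbb{R}^{n\times n}$, $C_j\in\mathbb{R}^{n_j\times n}$ $(j=1,\dots,N)$, let $Q\in\mathbb{R}^{n\times n}$ and $R_j\in\mathbb{R}^{n_j\times n_j}$ be symmetric positive definite, put $C=[C_1^T,\dots,C_N^T]^T$, and assume that the pair $(A,C)$ is observable. Let $\mathcal{L}=[l_{ij}]\in\mathbb{R}^{N\times N}$ be a doubly stochastic matrix with positive diagonal entries whose directed graph (with an edge $(i,j)$ iff $l_{ij}>0$) is strongly connected, and let $d$ be the diameter of this graph (the largest distance between two nodes). For $i\in\{1,\dots,N\}$ and $L\ge 0$ let $l_{ij}^{(L)}$ be the $(i,j)$ entry of $\mathcal{L}^L$ and set $$\tilde C_i^{(L)}=\big[\operatorname{sign}(l_{i1}^{(L)})C_1^T,\dots,\operatorname{sign}(l_{iN}^{(L)})C_N^T\big]^T,\quad \bar R_i^{(L)}=\operatorname{diag}\big(\operatorname{sign}(l_{ij}^{(L)})R_j\big)_{j=1}^N,\quad \tilde R_i^{(L)}=\operatorname{diag}\Big(\tfrac{1}{N l_{ij}^{(L)}}R_j\Big)_{j=1}^N ,$$ where $\tfrac1{Nl_{ij}^{(L)}}$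 is read as $0$ if $l_{ij}^{(L)}=0$ (for $L\ge d$ all $l_{ij}^{(L)}$ are positive, so that $\tilde C_i^{(L)}=C$ and $\bar R_i^{(L)}=\operatorname{diag}(R_1,\dots,R_N)$). Then for every $i$ and every $L\ge d$ the Riccati equation $$P=APA^T+Q-AP(\tilde C_i^{(L)})^T\big(\tilde C_i^{(L)}P(\tilde C_i^{(L)})^T+\tilde R_i^{(L)}\big)^{-1}\tilde C_i^{(L)}PA^T$$ has a unique positive semidefinite solution $P=P_i^{(L)}$, and, with $$K=AP_i^{(L)}(\tilde C_i^{(L)})^T\big(\tilde C_i^{(L)}P_i^{(L)}(\tilde C_i^{(L)})^T+\tilde R_i^{(L)}\big)^{-1},$$ the Lyapunov equation $$\tilde P=(A-K\tilde C_i^{(L)})\,\tilde P\,(A-K\tilde C_i^{(L)})^T+Q+K\bar R_i^{(L)}K^T$$ has a unique solution $\tilde P=\tilde P_i^{(L)}$ (the steady-state error covariance of sensor $i$). Moreover there are constants $M_2>0$ and $0<q_2<1$, depending neither on $i$ nor on $L$, such that $$\big\|\tilde P_i^{(L)}-P_i^{(L)}\big\|_2\le M_2\,q_2^L\qquad\text{for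 all } i\in\{1,\dots,N\}\text{ and all } L\ge d,$$ where $\|\cdot\|_2$ is the spectral norm (largest singular value). -/

import Mathlib

open scoped Matrix Matrix.Norms.L2Operator

noncomputable section

namespace CMDF

/-! Communication graph of a weight matrix: node `i` receives from node `j` iff `0 < W i j`. -/

/-- There is a directed walk with `k` edges from `i` to `j` in the graph of `W`. -/
def HasWalk {N : ℕ} (W : Matrix (Fin N) (Fin N) ℝ) (i j : Fin N) (k : ℕ) : Prop :=
  ∃ p : ℕ → Fin N, p 0 = i ∧ p k = j ∧ ∀ t < k, 0 < W (p t) (p (t + 1))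

/-- Strong connectivity: every node is joined to every node by a directed walk. -/
def StronglyConnected {N : ℕ} (W : Matrix (Fin N) (Fin N) ℝ) : Prop :=
  ∀ i j : Fin N, ∃ k : ℕ, HasWalk W i j k

/-- Length of a shortest directed walk from `i` to `j` (used for strongly connected graphs). -/
def graphDist {N : ℕ} (W : Matrix (Fin N) (Fin N) ℝ) (i j : Fin N) : ℕ :=
  sInf {k : ℕ | HasWalk W i j k}

/-- Diameter: the largest distance between two nodes. -/
def diameter {N : ℕ} (W : Matrix (Fin N) (Fin N) ℝ) : ℕ :=
  Finset.univ.sup fun e : Fin N × Fin N => graphDist W e.1 e.2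

/-- Observability of the pair `(A, C)`: the outputs `C A ^ k x`, `k = 0, 1, 2, …`, of the
noise-free system determine the initial state `x`. -/
def Observable {n : ℕ} {ι : Type*} (A : Matrix (Fin n) (Fin n) ℝ) (C : Matrix ι (Fin n) ℝ) :
    Prop :=
  ∀ x x' : Fin n → ℝ, (∀ k : ℕ, (C * A ^ k) *ᵥ x = (C * A ^ k) *ᵥ x') → x = x'

/-- The stacked observation matrix `[C₁ᵀ, …, C_Nᵀ]ᵀ`. -/
def stack {N n : ℕ} {m : Fin N → ℕ} (C : ∀ j : Fin N, Matrix (Fin (m j)) (Fin n) ℝ) :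
    Matrix (Σ j : Fin N, Fin (m j)) (Fin n) ℝ :=
  Matrix.of fun r s => C r.1 r.2 s

/-- The modified observation matrix of sensor `i` after `L` fusion steps: the stack of the
blocks `sign (l_ij^(L)) C_j`, where `l_ij^(L)` is the `(i, j)` entry of `W ^ L`. -/
def modC {N n : ℕ} {m : Fin N → ℕ} (W : Matrix (Fin N) (Fin N) ℝ)
    (C : ∀ j : Fin N, Matrix (Fin (m j)) (Fin n) ℝ) (i : Fin N) (L : ℕ) :
    Matrix (Σ j : Fin N, Fin (m j)) (Fin n) ℝ :=
  stack fun j => Real.sign ((W ^ L) i j) • C j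

/-- The block-diagonal matrix with blocks `sign (l_ij^(L)) R_j`. -/
def barR {N : ℕ} {m : Fin N → ℕ} (W : Matrix (Fin N) (Fin N) ℝ)
    (R : ∀ j : Fin N, Matrix (Fin (m j)) (Fin (m j)) ℝ) (i : Fin N) (L : ℕ) :
    Matrix (Σ j : Fin N, Fin (m j)) (Σ j : Fin N, Fin (m j)) ℝ :=
  Matrix.blockDiagonal' fun j => Real.sign ((W ^ L) i j) • R j

/-- The block-diagonal matrix with blocks `(1 / (N l_ij^(L))) R_j`, where the factor is `0`
if its denominator is `0`. -/
def modR {N : ℕ} {m : Fin N → ℕ} (W : Matrix (Fin N) (Fin N) ℝ)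
    (R : ∀ j : Fin N, Matrix (Fin (m j)) (Fin (m j)) ℝ) (i : Fin N) (L : ℕ) :
    Matrix (Σ j : Fin N, Fin (m j)) (Σ j : Fin N, Fin (m j)) ℝ :=
  Matrix.blockDiagonal' fun j => (1 / ((N : ℝ) * (W ^ L) i j)) • R j

section Equations

variable {n : ℕ} {ι : Type*} [Fintype ι] [DecidableEq ι]

/-- The gain `K_P = A P Cᵀ (C P Cᵀ + R)⁻¹`. -/
def gain (A : Matrix (Fin n) (Fin n) ℝ) (C : Matrix ι (Fin n) ℝ) (R : Matrix ι ι ℝ)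
    (P : Matrix (Fin n) (Fin n) ℝ) : Matrix (Fin n) ι ℝ :=
  A * P * Cᵀ * (C * P * Cᵀ + R)⁻¹

/-- The feedback matrix `A - K_P C`. -/
def feedback (A : Matrix (Fin n) (Fin n) ℝ) (C : Matrix ι (Fin n) ℝ) (R : Matrix ι ι ℝ)
    (P : Matrix (Fin n) (Fin n) ℝ) : Matrix (Fin n) (Fin n) ℝ :=
  A - A * P * Cᵀ * (C * P * Cᵀ + R)⁻¹ * C

/-- `P` is a (positive semidefinite) solution of the discrete-time algebraic Riccati equation
`P = A P Aᵀ + Q - A P Cᵀ (C P Cᵀ + R)⁻¹ C P Aᵀ`. -/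
def IsDARESolution (A : Matrix (Fin n) (Fin n) ℝ) (C : Matrix ι (Fin n) ℝ)
    (Q : Matrix (Fin n) (Fin n) ℝ) (R : Matrix ι ι ℝ) (P : Matrix (Fin n) (Fin n) ℝ) : Prop :=
  P.PosSemidef ∧
    P = A * P * Aᵀ + Q - A * P * Cᵀ * (C * P * Cᵀ + R)⁻¹ * C * P * Aᵀ

/-- `Pt` solves the discrete-time Lyapunov equation for the error covariance of the filter whose
gain is computed from `P`, `C`, `R`, when the actual noise covariance is `Rbar`. -/
def IsDLESolution (A : Matrix (Fin n) (Fin n) ℝ) (C : Matrix ι (Fin n) ℝ)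
    (Q : Matrix (Fin n) (Fin n) ℝ) (R Rbar : Matrix ι ι ℝ) (P Pt : Matrix (Fin n) (Fin n) ℝ) :
    Prop :=
  Pt = feedback A C R P * Pt * (feedback A C R P)ᵀ + Q + gain A C R P * Rbar * (gain A C R P)ᵀ

end Equations

end CMDF

end

/-!
The filters of all sensors are compared in the Loewner order, without perturbing the Riccati
equation.

*Riccati equation.* Completing the square in the gain (`closedLoop_eq_riccati_add`) shows that the
Riccati operator is the minimum, over all gains, of the one-step covariance propagation
`closedLoop`. Hence it is monotone, and a solution `P` lies below every `X` that satisfies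
`closedLoop X ≤ X` for some stabilizing gain (`IsDARESolution.le_of_closedLoop_le`). As
`F P Fᵀ ≤ P - Q` with `Q` positive definite, the gain of any solution is itself stabilizing, so two
solutions lie below each other. A solution exists as the limit of the increasing iterates started
at `0`. Their quadratic forms are bounded by the cost of steering a state of the dual system
`(Aᵀ, Cᵀ)` to the origin, which observability of `(A, C)` makes possible from every state
(`bddAbove_quadForm_iterate_riccati`). Stability of `F` also makes the Lyapunov equation uniquely
solvable.

*Consensus.* For `L` at least the diameter all entries of `W ^ L` are positive, so the sign factors
disappear, and `|N l_ij^(L) - 1|` is at most a geometric sequence `δ_L`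
(`exists_geometric_bound`).

*Comparison.* The true noise covariance differs from the one assumed in the filter, `R̃`, by at most
`δ_L R̃` in either direction. The term `K R̃ Kᵀ` occurs in `P - F P Fᵀ = Q + K R̃ Kᵀ`, so subtracting
the two steady-state equations gives `-δ_L P ≤ P̃ - P ≤ δ_L P`
(`IsDARESolution.smul_add_smul_sub_nonneg`). Finally `P ≤ c P₀`, where `P₀` solves the Riccati
equation for the true noise covariance and `R̃ ≤ c R`; here `c` comes from a common lower bound on
the weights (`IsDARESolution.le_smul`).
-/

noncomputable section

namespace CMDF

open Filter Topology
open scoped MatrixOrder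

/-! ### Lyapunov inequalities and stability -/

section Stability

variable {n : ℕ}

theorem conj_mono {ι κ : Type*} [Finite ι] [Fintype κ] (F : Matrix ι κ ℝ) {X Y : Matrix κ κ ℝ}
    (h : X ≤ Y) : F * X * Fᵀ ≤ F * Y * Fᵀ := by
  have := Matrix.PosSemidef.mul_mul_conjTranspose_same (Matrix.le_iff.1 h) F
  rw [Matrix.le_iff]
  simpa [Matrix.mul_sub, Matrix.sub_mul] using this

theorem conj_nonneg {ι κ : Type*} [Finite ι] [Fintype κ] (F : Matrix ι κ ℝ) {X : Matrix κ κ ℝ}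
    (h : 0 ≤ X) : 0 ≤ F * X * Fᵀ := by
  simpa using conj_mono F h

theorem quadForm_mono {ι : Type*} [Fintype ι] {X Y : Matrix ι ι ℝ} (h : X ≤ Y) (x : ι → ℝ) :
    x ⬝ᵥ X *ᵥ x ≤ x ⬝ᵥ Y *ᵥ x := by
  have := (Matrix.le_iff.1 h).dotProduct_mulVec_nonneg x
  rw [Matrix.sub_mulVec, dotProduct_sub] at this
  simpa using this

/-- Every symmetric matrix is dominated by a multiple of a given positive definite one. It is
applied also with `P = 1`, where it is a coercivity bound. -/
theorem exists_smul_le {ι : Type*} [Fintype ι] [DecidableEq ι] {P Q : Matrix ι ι ℝ}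
    (hQ : Q.PosDef) (hP : P.IsHermitian) : ∃ ε : ℝ, 0 < ε ∧ ε • P ≤ Q := by
  cases isEmpty_or_nonempty ι
  · exact ⟨1, one_pos, (Subsingleton.elim _ _).le⟩
  obtain ⟨r, hr, hrQ⟩ : ∃ r > 0, algebraMap ℝ (Matrix ι ι ℝ) r ≤ Q := by
    rw [CFC.exists_pos_algebraMap_le_iff (ha := hQ.1.isSelfAdjoint)]
    intro x hx
    rw [hQ.1.spectrum_real_eq_range_eigenvalues] at hx
    obtain ⟨i, rfl⟩ := hx
    exact hQ.eigenvalues_pos i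
  obtain ⟨c, hc⟩ : ∃ c, ∀ x ∈ spectrum ℝ P, x ≤ c := by
    rw [hP.spectrum_real_eq_range_eigenvalues]
    exact (Set.finite_range _).bddAbove
  have hPc : P ≤ algebraMap ℝ (Matrix ι ι ℝ) (|c| + 1) :=
    le_algebraMap_of_spectrum_le (fun x hx => (hc x hx).trans (by linarith [le_abs_self c]))
      hP.isSelfAdjoint
  have hc1 : 0 < |c| + 1 := by positivity
  refine ⟨r / (|c| + 1), by positivity, le_trans ?_ hrQ⟩
  calc (r / (|c| + 1)) • P ≤ (r / (|c| + 1)) • algebraMap ℝ (Matrix ι ι ℝ) (|c| + 1) :=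
        smul_le_smul_of_nonneg_left hPc (by positivity)
    _ = algebraMap ℝ (Matrix ι ι ℝ) r := by
        rw [Algebra.algebraMap_eq_smul_one, Algebra.algebraMap_eq_smul_one, smul_smul,
          div_mul_cancel₀ _ hc1.ne']

theorem nonneg_of_tendsto {ι : Type*} [Fintype ι] {f : ℕ → Matrix ι ι ℝ} {X : Matrix ι ι ℝ}
    (hf : Tendsto f atTop (𝓝 X)) (h : ∀ k, 0 ≤ f k) : 0 ≤ X := by
  refine Matrix.nonneg_iff_posSemidef.2 (Matrix.PosSemidef.of_dotProduct_mulVec_nonneg ?_ ?_)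
  · have h1 : Tendsto (fun k => (f k)ᴴ) atTop (𝓝 Xᴴ) :=
      (continuous_id.matrix_conjTranspose.tendsto X).comp hf
    refine tendsto_nhds_unique h1 (hf.congr fun k => ?_)
    exact (Matrix.nonneg_iff_posSemidef.1 (h k)).1.symm
  · intro x
    have hc : Continuous fun M : Matrix ι ι ℝ => star x ⬝ᵥ (M *ᵥ x) := by fun_prop
    exact ge_of_tendsto' ((hc.tendsto X).comp hf)
      fun k => (Matrix.nonneg_iff_posSemidef.1 (h k)).dotProduct_mulVec_nonneg x

/-- Lyapunov's criterion: since `Q` dominates some `ε • P`, conjugation by `F` contracts `P` by the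
factor `1 - ε`. -/
theorem tendsto_pow_zero_of_lyapunov {F P Q : Matrix (Fin n) (Fin n) ℝ} (hP : P.PosDef)
    (hQ : Q.PosDef) (h : F * P * Fᵀ + Q ≤ P) : Tendsto (fun k => F ^ k) atTop (𝓝 0) := by
  obtain ⟨ε, hε, hεP⟩ := exists_smul_le hQ hP.1
  obtain ⟨r, hr, hrP⟩ := exists_smul_le hP (Matrix.isHermitian_one (n := Fin n))
  -- `max` keeps the contraction factor nonnegative, as the powers below require
  set ρ := max (1 - ε) 0 with hρ
  have hρ0 : 0 ≤ ρ := le_max_right _ _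
  have hρ1 : ρ < 1 := max_lt (by linarith) one_pos
  have hstep : F * P * Fᵀ ≤ ρ • P := by
    calc F * P * Fᵀ ≤ P - Q := le_sub_iff_add_le.2 h
      _ ≤ P - ε • P := sub_le_sub_left hεP _
      _ = (1 - ε) • P := by rw [sub_smul, one_smul]
      _ ≤ ρ • P := smul_le_smul_of_nonneg_right (le_max_left _ _) hP.posSemidef.nonneg
  have hpow : ∀ k, F ^ k * P * (F ^ k)ᵀ ≤ ρ ^ k • P := by
    intro k
    induction k with
    | zero => simp
    | succ k ih =>
      calc F ^ (k + 1) * P * (F ^ (k + 1))ᵀ = F ^ k * (F * P * Fᵀ) * (F ^ k)ᵀ := by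
            simp only [pow_succ, Matrix.transpose_mul, Matrix.mul_assoc]
        _ ≤ F ^ k * (ρ • P) * (F ^ k)ᵀ := conj_mono _ hstep
        _ = ρ • (F ^ k * P * (F ^ k)ᵀ) := by simp
        _ ≤ ρ • (ρ ^ k • P) := smul_le_smul_of_nonneg_left ih hρ0
        _ = ρ ^ (k + 1) • P := by rw [smul_smul, pow_succ']
  have hgram : ∀ k, r • (F ^ k * (F ^ k)ᵀ) ≤ ρ ^ k • P := by
    intro k
    refine le_trans ?_ (hpow k)
    simpa using conj_mono (F ^ k) hrP
  have hentry : ∀ k i j, (F ^ k) i j ^ 2 ≤ ρ ^ k * (P i i / r) := by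
    intro k i j
    have h1 : r * (F ^ k * (F ^ k)ᵀ) i i ≤ ρ ^ k * P i i := by
      have := quadForm_mono (hgram k) (Pi.single i 1)
      simpa using this
    have h2 : (F ^ k) i j ^ 2 ≤ (F ^ k * (F ^ k)ᵀ) i i := by
      rw [Matrix.mul_apply]
      simp only [Matrix.transpose_apply, ← sq]
      exact Finset.single_le_sum (f := fun l => (F ^ k) i l ^ 2) (fun l _ => sq_nonneg _)
        (Finset.mem_univ j)
    rw [← mul_div_assoc, le_div_iff₀ hr]
    nlinarith
  refine tendsto_pi_nhds.2 fun i => tendsto_pi_nhds.2 fun j => ?_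
  have hlim : Tendsto (fun k => ρ ^ k * (P i i / r)) atTop (𝓝 0) := by
    simpa using (tendsto_pow_atTop_nhds_zero_of_lt_one hρ0 hρ1).mul_const (P i i / r)
  have hsq := squeeze_zero (fun k => sq_nonneg ((F ^ k) i j)) (fun k => hentry k i j) hlim
  refine tendsto_zero_iff_abs_tendsto_zero _ |>.2 ?_
  simpa [Real.sqrt_sq_eq_abs, Function.comp_def] using hsq.sqrt

theorem tendsto_conj_pow_zero {F : Matrix (Fin n) (Fin n) ℝ}
    (hF : Tendsto (fun k => F ^ k) atTop (𝓝 0)) (D : Matrix (Fin n) (Fin n) ℝ) :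
    Tendsto (fun k => F ^ k * D * (F ^ k)ᵀ) atTop (𝓝 0) := by
  have hc : Continuous fun X : Matrix (Fin n) (Fin n) ℝ => X * D * Xᵀ := by fun_prop
  simpa [Function.comp_def] using (hc.tendsto 0).comp hF

/-- Comparison principle for a stable `F`: iterating the hypothesis gives `F ^ k D (F ^ k)ᵀ ≤ D`, and
the left side tends to zero. Symmetry of `D` is part of the conclusion. -/
theorem nonneg_of_conj_le {F D : Matrix (Fin n) (Fin n) ℝ}
    (hF : Tendsto (fun k => F ^ k) atTop (𝓝 0)) (h : F * D * Fᵀ ≤ D) : 0 ≤ D := by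
  have hpow : ∀ k, F ^ k * D * (F ^ k)ᵀ ≤ D := by
    intro k
    induction k with
    | zero => simp
    | succ k ih =>
      calc F ^ (k + 1) * D * (F ^ (k + 1))ᵀ = F ^ k * (F * D * Fᵀ) * (F ^ k)ᵀ := by
            simp only [pow_succ, Matrix.transpose_mul, Matrix.mul_assoc]
        _ ≤ F ^ k * D * (F ^ k)ᵀ := conj_mono _ h
        _ ≤ D := ih
  refine nonneg_of_tendsto (f := fun k => D - F ^ k * D * (F ^ k)ᵀ) ?_
    fun k => sub_nonneg.2 (hpow k)
  simpa using (tendsto_conj_pow_zero hF D).const_sub D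

theorem eq_zero_of_conj_eq {F D : Matrix (Fin n) (Fin n) ℝ}
    (hF : Tendsto (fun k => F ^ k) atTop (𝓝 0)) (h : F * D * Fᵀ = D) : D = 0 := by
  have hpow : ∀ k, F ^ k * D * (F ^ k)ᵀ = D := by
    intro k
    induction k with
    | zero => simp
    | succ k ih =>
      calc F ^ (k + 1) * D * (F ^ (k + 1))ᵀ = F ^ k * (F * D * Fᵀ) * (F ^ k)ᵀ := by
            simp only [pow_succ, Matrix.transpose_mul, Matrix.mul_assoc]
        _ = D := by rw [h, ih]
  exact tendsto_nhds_unique (tendsto_const_nhds.congr fun k => (hpow k).symm)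
    (tendsto_conj_pow_zero hF D)

theorem existsUnique_lyapunov {F : Matrix (Fin n) (Fin n) ℝ}
    (hF : Tendsto (fun k => F ^ k) atTop (𝓝 0)) (E : Matrix (Fin n) (Fin n) ℝ) :
    ∃! X : Matrix (Fin n) (Fin n) ℝ, X = F * X * Fᵀ + E := by
  let T : Matrix (Fin n) (Fin n) ℝ →ₗ[ℝ] Matrix (Fin n) (Fin n) ℝ :=
    { toFun := fun X => X - F * X * Fᵀ
      map_add' := fun X Y => by rw [Matrix.mul_add, Matrix.add_mul]; abel
      map_smul' := fun c X => by simp [smul_sub] }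
  have hinj : Function.Injective T := by
    rw [← LinearMap.ker_eq_bot, LinearMap.ker_eq_bot']
    intro D hD
    exact eq_zero_of_conj_eq hF (sub_eq_zero.1 hD).symm
  have hiff : ∀ X, X = F * X * Fᵀ + E ↔ T X = E := fun X => sub_eq_iff_eq_add'.symm
  obtain ⟨X, hX⟩ := LinearMap.surjective_of_injective hinj E
  refine ⟨X, (hiff X).2 hX, fun Y hY => hinj ?_⟩
  rw [hX, (hiff Y).1 hY]

end Stability

/-! ### The Riccati equation -/

section RiccatiEquation

variable {n : ℕ} {ι : Type*} [Fintype ι]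
  {A : Matrix (Fin n) (Fin n) ℝ} {C : Matrix ι (Fin n) ℝ} {Q : Matrix (Fin n) (Fin n) ℝ}
  {R : Matrix ι ι ℝ} {P P' X : Matrix (Fin n) (Fin n) ℝ}

/-- One-step propagation of the error covariance `P` by a filter with an arbitrary gain `K`. -/
def closedLoop (A : Matrix (Fin n) (Fin n) ℝ) (C : Matrix ι (Fin n) ℝ)
    (Q : Matrix (Fin n) (Fin n) ℝ) (R : Matrix ι ι ℝ) (K : Matrix (Fin n) ι ℝ)
    (P : Matrix (Fin n) (Fin n) ℝ) : Matrix (Fin n) (Fin n) ℝ :=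
  (A - K * C) * P * (A - K * C)ᵀ + Q + K * R * Kᵀ

theorem innovation_posDef (hR : R.PosDef) (hP : 0 ≤ P) : (C * P * Cᵀ + R).PosDef :=
  Matrix.PosDef.posSemidef_add (Matrix.nonneg_iff_posSemidef.1 (conj_nonneg C hP)) hR

theorem transpose_eq_of_nonneg {κ : Type*} [Fintype κ] {X : Matrix κ κ ℝ} (hX : 0 ≤ X) :
    Xᵀ = X := by
  simpa using (Matrix.nonneg_iff_posSemidef.1 hX).1.eq

theorem closedLoop_mono (K : Matrix (Fin n) ι ℝ) (h : P ≤ P') :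
    closedLoop A C Q R K P ≤ closedLoop A C Q R K P' := by
  unfold closedLoop
  gcongr
  exact conj_mono _ h

variable [DecidableEq ι]

/-- The Riccati operator, whose positive semidefinite fixed points are the solutions of the
discrete-time algebraic Riccati equation. -/
def riccati (A : Matrix (Fin n) (Fin n) ℝ) (C : Matrix ι (Fin n) ℝ)
    (Q : Matrix (Fin n) (Fin n) ℝ) (R : Matrix ι ι ℝ) (P : Matrix (Fin n) (Fin n) ℝ) :
    Matrix (Fin n) (Fin n) ℝ :=
  A * P * Aᵀ + Q - A * P * Cᵀ * (C * P * Cᵀ + R)⁻¹ * C * P * Aᵀ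

/-- Completion of squares in the gain. -/
theorem closedLoop_eq_riccati_add (hR : R.PosDef) (hP : 0 ≤ P) (K : Matrix (Fin n) ι ℝ) :
    closedLoop A C Q R K P = riccati A C Q R P +
      (K - gain A C R P) * (C * P * Cᵀ + R) * (K - gain A C R P)ᵀ := by
  have hS := innovation_posDef (C := C) hR hP
  have hPt := transpose_eq_of_nonneg hP
  have hSt : (C * P * Cᵀ + R)ᵀ = C * P * Cᵀ + R := transpose_eq_of_nonneg hS.posSemidef.nonneg
  have hdet : IsUnit (C * P * Cᵀ + R).det := (Matrix.isUnit_iff_isUnit_det _).1 hS.isUnit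
  have hg : gain A C R P * (C * P * Cᵀ + R) = A * P * Cᵀ := by
    rw [gain, Matrix.nonsing_inv_mul_cancel_right _ _ hdet]
  have hgt : (C * P * Cᵀ + R) * (gain A C R P)ᵀ = C * P * Aᵀ := by
    have := congrArg Matrix.transpose hg
    rwa [Matrix.transpose_mul, hSt, Matrix.transpose_mul, Matrix.transpose_mul, hPt,
      Matrix.transpose_transpose, ← Matrix.mul_assoc] at this
  have hric : riccati A C Q R P = A * P * Aᵀ + Q - gain A C R P * (C * P * Aᵀ) := by
    simp only [riccati, gain, Matrix.mul_assoc]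
  have hsq : (K - gain A C R P) * (C * P * Cᵀ + R) * (K - gain A C R P)ᵀ =
      K * (C * P * Cᵀ + R) * Kᵀ - K * (C * P * Aᵀ) - A * P * Cᵀ * Kᵀ
        + gain A C R P * (C * P * Aᵀ) := by
    rw [Matrix.sub_mul, Matrix.transpose_sub, Matrix.mul_sub, Matrix.sub_mul, Matrix.sub_mul, hg,
      Matrix.mul_assoc K _ (gain A C R P)ᵀ, hgt, ← hg, Matrix.mul_assoc (gain A C R P) _ _,
      Matrix.mul_assoc (gain A C R P) _ _, hgt]
    abel
  rw [hric, hsq, closedLoop]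
  simp only [Matrix.mul_sub, Matrix.sub_mul, Matrix.mul_add, Matrix.add_mul, Matrix.mul_assoc,
    Matrix.transpose_sub, Matrix.transpose_mul]
  abel

theorem riccati_le_closedLoop (hR : R.PosDef) (hP : 0 ≤ P) (K : Matrix (Fin n) ι ℝ) :
    riccati A C Q R P ≤ closedLoop A C Q R K P := by
  rw [closedLoop_eq_riccati_add hR hP K]
  exact le_add_of_nonneg_right (conj_nonneg _ (innovation_posDef hR hP).posSemidef.nonneg)

theorem closedLoop_gain (hR : R.PosDef) (hP : 0 ≤ P) :
    closedLoop A C Q R (gain A C R P) P = riccati A C Q R P := by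
  rw [closedLoop_eq_riccati_add hR hP]
  simp

theorem riccati_mono (hR : R.PosDef) (hP : 0 ≤ P) (h : P ≤ P') :
    riccati A C Q R P ≤ riccati A C Q R P' :=
  calc riccati A C Q R P ≤ closedLoop A C Q R (gain A C R P') P := riccati_le_closedLoop hR hP _
    _ ≤ closedLoop A C Q R (gain A C R P') P' := closedLoop_mono _ h
    _ = riccati A C Q R P' := closedLoop_gain hR (hP.trans h)

theorem le_riccati (hR : R.PosDef) (hP : 0 ≤ P) : Q ≤ riccati A C Q R P := by
  rw [← closedLoop_gain hR hP, closedLoop, add_right_comm]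
  exact le_add_of_nonneg_left (add_nonneg (conj_nonneg _ hP) (conj_nonneg _ hR.posSemidef.nonneg))

theorem isDARESolution_iff :
    IsDARESolution A C Q R P ↔ 0 ≤ P ∧ riccati A C Q R P = P := by
  rw [IsDARESolution, Matrix.nonneg_iff_posSemidef, eq_comm (a := P)]
  rfl

theorem IsDARESolution.nonneg (h : IsDARESolution A C Q R P) : 0 ≤ P :=
  Matrix.nonneg_iff_posSemidef.2 h.1

theorem IsDARESolution.closedLoop_eq (hR : R.PosDef) (h : IsDARESolution A C Q R P) :
    closedLoop A C Q R (gain A C R P) P = P :=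
  (closedLoop_gain hR h.nonneg).trans (isDARESolution_iff.1 h).2

theorem IsDARESolution.posDef (hQ : Q.PosDef) (hR : R.PosDef) (h : IsDARESolution A C Q R P) :
    P.PosDef := by
  have h1 : Q ≤ P := by
    conv_rhs => rw [← (isDARESolution_iff.1 h).2]
    exact le_riccati hR h.nonneg
  simpa using hQ.add_posSemidef (Matrix.le_iff.1 h1)

theorem IsDARESolution.tendsto_feedback_pow (hQ : Q.PosDef) (hR : R.PosDef)
    (h : IsDARESolution A C Q R P) :
    Tendsto (fun k => (A - gain A C R P * C) ^ k) atTop (𝓝 0) := by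
  refine tendsto_pow_zero_of_lyapunov (h.posDef hQ hR) hQ ?_
  conv_rhs => rw [← h.closedLoop_eq hR]
  exact le_add_of_nonneg_right (conj_nonneg _ hR.posSemidef.nonneg)

/-- Optimality of the steady-state filter: a stabilizing constant gain has no smaller error
covariance. -/
theorem IsDARESolution.le_of_closedLoop_le (hR : R.PosDef) (h : IsDARESolution A C Q R P)
    {K : Matrix (Fin n) ι ℝ} (hK : Tendsto (fun k => (A - K * C) ^ k) atTop (𝓝 0))
    (hX : closedLoop A C Q R K X ≤ X) : P ≤ X := by
  have h1 : P ≤ closedLoop A C Q R K P := by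
    conv_lhs => rw [← (isDARESolution_iff.1 h).2]
    exact riccati_le_closedLoop hR h.nonneg K
  rw [← sub_nonneg]
  refine nonneg_of_conj_le hK ?_
  calc (A - K * C) * (X - P) * (A - K * C)ᵀ
      = closedLoop A C Q R K X - closedLoop A C Q R K P := by
        rw [closedLoop, closedLoop, Matrix.mul_sub, Matrix.sub_mul]; abel
    _ ≤ X - P := sub_le_sub hX h1

theorem IsDARESolution.unique (hQ : Q.PosDef) (hR : R.PosDef) (h : IsDARESolution A C Q R P)
    (h' : IsDARESolution A C Q R P') : P = P' :=
  le_antisymm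
    (h.le_of_closedLoop_le hR (h'.tendsto_feedback_pow hQ hR) (h'.closedLoop_eq hR).le)
    (h'.le_of_closedLoop_le hR (h.tendsto_feedback_pow hQ hR) (h.closedLoop_eq hR).le)

theorem quadForm_conj {κ κ' : Type*} [Fintype κ] [Fintype κ'] (F : Matrix κ κ' ℝ)
    (X : Matrix κ' κ' ℝ) (x : κ → ℝ) :
    x ⬝ᵥ (F * X * Fᵀ) *ᵥ x = (Fᵀ *ᵥ x) ⬝ᵥ X *ᵥ (Fᵀ *ᵥ x) := by
  rw [← Matrix.mulVec_mulVec, ← Matrix.mulVec_mulVec, Matrix.dotProduct_mulVec,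
    ← Matrix.mulVec_transpose]

theorem quadForm_nonneg {κ : Type*} [Fintype κ] {X : Matrix κ κ ℝ} (hX : 0 ≤ X) (x : κ → ℝ) :
    0 ≤ x ⬝ᵥ X *ᵥ x := by
  simpa using quadForm_mono hX x

/-- Dual optimal control reading of the Riccati operator: its quadratic form at `x` is at most
the cost of applying any input `v` to the system `(Aᵀ, Cᵀ)` at the state `x`. -/
theorem quadForm_riccati_le (hR : R.PosDef) (hP : 0 ≤ P) (x : Fin n → ℝ)
    (v : ι → ℝ) :
    x ⬝ᵥ riccati A C Q R P *ᵥ x ≤ x ⬝ᵥ Q *ᵥ x + v ⬝ᵥ R *ᵥ v +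
      (Aᵀ *ᵥ x - Cᵀ *ᵥ v) ⬝ᵥ P *ᵥ (Aᵀ *ᵥ x - Cᵀ *ᵥ v) := by
  rcases eq_or_ne x 0 with rfl | hx
  · have h1 := quadForm_nonneg hR.posSemidef.nonneg v
    have h2 := quadForm_nonneg hP (Aᵀ *ᵥ 0 - Cᵀ *ᵥ v)
    simp only [zero_dotProduct, zero_add]
    linarith
  -- a rank-one gain whose transpose sends `x` to `v`
  set K : Matrix (Fin n) ι ℝ := (x ⬝ᵥ x)⁻¹ • Matrix.vecMulVec x v with hK
  have hxx : x ⬝ᵥ x ≠ 0 := fun h => hx (dotProduct_self_eq_zero.1 h)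
  have hKx : Kᵀ *ᵥ x = v := by
    rw [hK, Matrix.transpose_smul, Matrix.transpose_vecMulVec, Matrix.smul_mulVec,
      Matrix.vecMulVec_mulVec]
    ext i
    simp [hxx, mul_comm]
  have hFx : (A - K * C)ᵀ *ᵥ x = Aᵀ *ᵥ x - Cᵀ *ᵥ v := by
    rw [Matrix.transpose_sub, Matrix.sub_mulVec, Matrix.transpose_mul, ← Matrix.mulVec_mulVec, hKx]
  have h := quadForm_mono (riccati_le_closedLoop (A := A) (C := C) (Q := Q) hR hP K) x
  rw [closedLoop, Matrix.add_mulVec, Matrix.add_mulVec, dotProduct_add, dotProduct_add,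
    quadForm_conj, quadForm_conj, hKx, hFx] at h
  linarith

theorem finrank_le_finrank_comap {V : Type*} [AddCommGroup V] [Module ℝ V] [FiniteDimensional ℝ V]
    (f : V →ₗ[ℝ] V) (T : Submodule ℝ V) :
    Module.finrank ℝ T ≤ Module.finrank ℝ (T.comap f) := by
  have hinj : Function.Injective ((T.comap f).mapQ T f le_rfl) := by
    rw [← LinearMap.ker_eq_bot, Submodule.ker_mapQ, Submodule.mkQ_map_self]
  have h1 := LinearMap.finrank_le_finrank_of_injective hinj
  have h2 := T.finrank_quotient_add_finrank
  have h3 := (T.comap f).finrank_quotient_add_finrank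
  omega

/-- For a controllable pair `(f, g)`, a subspace that contains every state which some input steers
into it in one step is the whole space. -/
theorem eq_top_of_steering {V U : Type*} [AddCommGroup V] [Module ℝ V] [FiniteDimensional ℝ V]
    [AddCommGroup U] [Module ℝ U] (f : V →ₗ[ℝ] V) (g : U →ₗ[ℝ] V) (S : Submodule ℝ V)
    (hS : ∀ x v, f x - g v ∈ S → x ∈ S)
    (hfg : ∀ T : Submodule ℝ V, T ≤ T.comap f → LinearMap.range g ≤ T → T = ⊤) : S = ⊤ := by
  have hcomap : (S ⊔ LinearMap.range g).comap f ≤ S := by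
    intro x hx
    obtain ⟨s, hs, w, ⟨v, rfl⟩, hsw⟩ := Submodule.mem_sup.1 (Submodule.mem_comap.1 hx)
    refine hS x v ?_
    rwa [← hsw, add_sub_cancel_right]
  -- comparing dimensions, adding the range of `g` does not enlarge `S`
  have hsup : S = S ⊔ LinearMap.range g :=
    Submodule.eq_of_le_of_finrank_le le_sup_left
      ((finrank_le_finrank_comap f _).trans (Submodule.finrank_mono hcomap))
  rw [← hsup] at hcomap
  have hinv : S.comap f = S :=
    Submodule.eq_of_le_of_finrank_le hcomap (finrank_le_finrank_comap f S)
  exact hfg S hinv.ge (le_sup_right.trans hsup.ge)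

theorem Observable.eq_top {ι : Type*} [Fintype ι] {C : Matrix ι (Fin n) ℝ}
    (h : Observable A C) (T : Submodule ℝ (Fin n → ℝ))
    (hA : T ≤ T.comap Aᵀ.mulVecLin) (hC : LinearMap.range Cᵀ.mulVecLin ≤ T) : T = ⊤ := by
  by_contra hT
  obtain ⟨φ, hφ, hTφ⟩ := T.exists_le_ker_of_lt_top (lt_top_iff_ne_top.2 hT)
  obtain ⟨w, rfl⟩ := (dotProductEquiv ℝ (Fin n)).surjective φ
  have hmem : ∀ (v : ι → ℝ) (k : ℕ), (C * A ^ k)ᵀ *ᵥ v ∈ T := by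
    intro v k
    induction k with
    | zero => simpa [Matrix.mulVec_transpose] using hC ⟨v, rfl⟩
    | succ k ih =>
      have := hA ih
      rw [Submodule.mem_comap, Matrix.mulVecLin_apply, Matrix.mulVec_mulVec,
        ← Matrix.transpose_mul, Matrix.mul_assoc, ← pow_succ] at this
      exact this
  have hzero : ∀ k : ℕ, (C * A ^ k) *ᵥ w = 0 := by
    intro k
    refine dotProduct_eq_zero_iff.1 fun v => ?_
    have := hTφ (hmem v k)
    rw [LinearMap.mem_ker, dotProductEquiv_apply_apply, Matrix.mulVec_transpose,
      dotProduct_comm, ← Matrix.dotProduct_mulVec] at this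
    rw [dotProduct_comm]
    exact this
  refine hφ ?_
  rw [h w 0 fun k => by rw [hzero, Matrix.mulVec_zero], map_zero]

theorem iterate_riccati_nonneg (hQ : Q.PosDef) (hR : R.PosDef) (k : ℕ) :
    0 ≤ (riccati A C Q R)^[k] 0 := by
  induction k with
  | zero => simp
  | succ k ih =>
    rw [Function.iterate_succ_apply']
    exact hQ.posSemidef.nonneg.trans (le_riccati hR ih)

theorem iterate_riccati_mono (hQ : Q.PosDef) (hR : R.PosDef) :
    Monotone fun k => (riccati A C Q R)^[k] 0 := by
  refine monotone_nat_of_le_succ fun k => ?_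
  induction k with
  | zero => simpa using iterate_riccati_nonneg hQ hR 1
  | succ k ih =>
    rw [Function.iterate_succ_apply', Function.iterate_succ_apply']
    exact riccati_mono hR (iterate_riccati_nonneg hQ hR k) ih

/-- Observability makes the Riccati iterates started at `0` pointwise bounded. The vectors where
the quadratic forms stay bounded form a subspace, which by `quadForm_riccati_le` contains
every state that an input steers into it. -/
theorem bddAbove_quadForm_iterate_riccati (hQ : Q.PosDef) (hR : R.PosDef) (hobs : Observable A C)
    (x : Fin n → ℝ) :
    BddAbove (Set.range fun k => x ⬝ᵥ (riccati A C Q R)^[k] 0 *ᵥ x) := by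
  set p : ℕ → Matrix (Fin n) (Fin n) ℝ := fun k => (riccati A C Q R)^[k] 0
  have hp : ∀ k, 0 ≤ p k := iterate_riccati_nonneg hQ hR
  let S : Submodule ℝ (Fin n → ℝ) :=
    { carrier := {x | ∃ b, ∀ k, x ⬝ᵥ p k *ᵥ x ≤ b}
      zero_mem' := ⟨0, fun k => by simp⟩
      add_mem' := by
        rintro x y ⟨b, hb⟩ ⟨c, hc⟩
        refine ⟨2 * b + 2 * c, fun k => ?_⟩
        -- the parallelogram law
        have h := quadForm_nonneg (hp k) (x - y)
        have e : (x + y) ⬝ᵥ p k *ᵥ (x + y) + (x - y) ⬝ᵥ p k *ᵥ (x - y)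
            = 2 * (x ⬝ᵥ p k *ᵥ x) + 2 * (y ⬝ᵥ p k *ᵥ y) := by
          simp only [Matrix.mulVec_add, Matrix.mulVec_sub, add_dotProduct, sub_dotProduct,
            dotProduct_add, dotProduct_sub]
          ring
        linarith [hb k, hc k]
      smul_mem' := by
        rintro a x ⟨b, hb⟩
        refine ⟨a * a * b, fun k => ?_⟩
        rw [Matrix.mulVec_smul, dotProduct_smul, smul_dotProduct, smul_eq_mul, smul_eq_mul,
          ← mul_assoc]
        exact mul_le_mul_of_nonneg_left (hb k) (mul_self_nonneg a) }
  have hS : S = ⊤ := by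
    refine eq_top_of_steering Aᵀ.mulVecLin Cᵀ.mulVecLin S ?_ hobs.eq_top
    rintro x v ⟨b, hb⟩
    refine ⟨x ⬝ᵥ Q *ᵥ x + v ⬝ᵥ R *ᵥ v + b, fun k => ?_⟩
    cases k with
    | zero =>
      have h1 := quadForm_nonneg hQ.posSemidef.nonneg x
      have h2 := quadForm_nonneg hR.posSemidef.nonneg v
      have h3 := (quadForm_nonneg (hp 0) _).trans (hb 0)
      simp only [p, Function.iterate_zero, id_eq, Matrix.zero_mulVec, dotProduct_zero]
      linarith
    | succ k =>
      have h := quadForm_riccati_le (A := A) (C := C) (Q := Q) hR (hp k) x v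
      have h1 := hb k
      simp only [Matrix.mulVecLin_apply] at h1
      simp only [p, Function.iterate_succ_apply'] at h h1 ⊢
      linarith
  obtain ⟨b, hb⟩ : x ∈ S := hS ▸ Submodule.mem_top
  exact ⟨b, by rintro _ ⟨k, rfl⟩; exact hb k⟩

/-- Monotone convergence for symmetric matrices. -/
theorem exists_tendsto_of_monotone {p : ℕ → Matrix (Fin n) (Fin n) ℝ} (hp : ∀ k, 0 ≤ p k)
    (hmono : Monotone p) (hbdd : ∀ x, BddAbove (Set.range fun k => x ⬝ᵥ p k *ᵥ x)) :
    ∃ X, Tendsto p atTop (𝓝 X) := by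
  have hq : ∀ x : Fin n → ℝ, ∃ l, Tendsto (fun k => x ⬝ᵥ p k *ᵥ x) atTop (𝓝 l) := fun x =>
    ⟨_, tendsto_atTop_ciSup (fun _ _ h => quadForm_mono (hmono h) x) (hbdd x)⟩
  choose l hl using hq
  let e : Fin n → Fin n → ℝ := fun i => Pi.single i 1
  refine ⟨Matrix.of fun i j => (l (e i + e j) - l (e i) - l (e j)) / 2,
    tendsto_pi_nhds.2 fun i => tendsto_pi_nhds.2 fun j => ?_⟩
  refine ((((hl (e i + e j)).sub (hl (e i))).sub (hl (e j))).div_const 2).congr fun k => ?_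
  have hsymm : p k j i = p k i j := congrFun (congrFun (transpose_eq_of_nonneg (hp k)) i) j
  simp only [e, Matrix.mulVec_add, dotProduct_add, add_dotProduct, Matrix.mulVec_single_one,
    single_one_dotProduct, Matrix.col_apply, hsymm]
  ring

theorem continuousAt_riccati (hR : R.PosDef) (hP : 0 ≤ P) : ContinuousAt (riccati A C Q R) P := by
  have hdet : (C * P * Cᵀ + R).det ≠ 0 := (innovation_posDef hR hP).det_pos.ne'
  have hring : ContinuousAt Ring.inverse (C * P * Cᵀ + R).det := by
    rw [Ring.inverse_eq_inv']
    exact continuousAt_inv₀ hdet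
  have h1 : Continuous fun X : Matrix (Fin n) (Fin n) ℝ => C * X * Cᵀ + R :=
    ((continuous_const.matrix_mul continuous_id).matrix_mul continuous_const).add
      continuous_const
  have hinv : Tendsto (fun X : Matrix (Fin n) (Fin n) ℝ => (C * X * Cᵀ + R)⁻¹) (𝓝 P)
      (𝓝 (C * P * Cᵀ + R)⁻¹) :=
    (continuousAt_matrix_inv _ hring).tendsto.comp (h1.tendsto P)
  have hl : Continuous fun Y : Matrix (Fin n) (Fin n) ℝ × Matrix ι ι ℝ =>
      A * Y.1 * Aᵀ + Q - A * Y.1 * Cᵀ * Y.2 * C * Y.1 * Aᵀ :=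
    (((continuous_const.matrix_mul continuous_fst).matrix_mul continuous_const).add
      continuous_const).sub
      ((((((continuous_const.matrix_mul continuous_fst).matrix_mul continuous_const).matrix_mul
        continuous_snd).matrix_mul continuous_const).matrix_mul continuous_fst).matrix_mul
        continuous_const)
  have h2 : Tendsto (fun X : Matrix (Fin n) (Fin n) ℝ => (X, (C * X * Cᵀ + R)⁻¹)) (𝓝 P)
      (𝓝 (P, (C * P * Cᵀ + R)⁻¹)) := tendsto_id.prodMk_nhds hinv
  have h3 := (hl.tendsto (P, (C * P * Cᵀ + R)⁻¹)).comp h2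
  simp only [Function.comp_def] at h3
  exact h3

/-- The Riccati iterates started at `0` increase to a solution. -/
theorem exists_isDARESolution (hQ : Q.PosDef) (hR : R.PosDef) (hobs : Observable A C) :
    ∃ P, IsDARESolution A C Q R P := by
  obtain ⟨P, hP⟩ := exists_tendsto_of_monotone (iterate_riccati_nonneg hQ hR)
    (iterate_riccati_mono hQ hR) (bddAbove_quadForm_iterate_riccati hQ hR hobs)
  have hP0 : 0 ≤ P := nonneg_of_tendsto hP (iterate_riccati_nonneg hQ hR)
  refine ⟨P, isDARESolution_iff.2 ⟨hP0, ?_⟩⟩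
  have h1 := (continuousAt_riccati (A := A) (C := C) (Q := Q) hR hP0).tendsto.comp hP
  refine tendsto_nhds_unique h1 ?_
  refine ((tendsto_add_atTop_iff_nat 1).2 hP).congr fun k => ?_
  rw [Function.iterate_succ_apply', Function.comp_apply]

end RiccatiEquation

/-! ### Powers of a doubly stochastic matrix -/

section Consensus

variable {N : ℕ} {W : Matrix (Fin N) (Fin N) ℝ}

theorem pow_apply_pos_of_hasWalk (hW : W ∈ doublyStochastic ℝ (Fin N)) {i j : Fin N} {k : ℕ}
    (h : HasWalk W i j k) : 0 < (W ^ k) i j := by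
  obtain ⟨p, rfl, rfl, hp⟩ := h
  induction k with
  | zero => simp
  | succ k ih =>
    rw [pow_succ, Matrix.mul_apply]
    refine Finset.sum_pos' (fun l _ => mul_nonneg
      (nonneg_of_mem_doublyStochastic (pow_mem hW k)) (nonneg_of_mem_doublyStochastic hW))
      ⟨p k, Finset.mem_univ _, mul_pos (ih fun t ht => hp t (by omega)) (hp k (by omega))⟩

theorem pow_apply_pos_mono (hW : W ∈ doublyStochastic ℝ (Fin N)) (hdiag : ∀ i, 0 < W i i)
    {i j : Fin N} {k l : ℕ} (hkl : k ≤ l) (h : 0 < (W ^ k) i j) : 0 < (W ^ l) i j := by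
  induction l, hkl using Nat.le_induction with
  | base => exact h
  | succ l _ ih =>
    rw [pow_succ, Matrix.mul_apply]
    exact Finset.sum_pos' (fun t _ => mul_nonneg
      (nonneg_of_mem_doublyStochastic (pow_mem hW l)) (nonneg_of_mem_doublyStochastic hW))
      ⟨j, Finset.mem_univ _, mul_pos ih (hdiag j)⟩

theorem pow_apply_pos_of_diameter_le (hW : W ∈ doublyStochastic ℝ (Fin N))
    (hdiag : ∀ i, 0 < W i i) (hconn : StronglyConnected W) {L : ℕ} (hL : diameter W ≤ L)
    (i j : Fin N) : 0 < (W ^ L) i j := by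
  have hdist : HasWalk W i j (graphDist W i j) := Nat.sInf_mem (hconn i j)
  have hle : graphDist W i j ≤ diameter W :=
    Finset.le_sup (f := fun e : Fin N × Fin N => graphDist W e.1 e.2) (Finset.mem_univ (i, j))
  exact pow_apply_pos_mono hW hdiag (hle.trans hL) (pow_apply_pos_of_hasWalk hW hdist)

theorem exists_pos_le_apply {ι : Type*} [Finite ι] {X : Matrix ι ι ℝ} (h : ∀ i j, 0 < X i j) :
    ∃ a > 0, ∀ i j, a ≤ X i j := by
  cases isEmpty_or_nonempty ι
  · exact ⟨1, one_pos, fun i => isEmptyElim i⟩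
  obtain ⟨e, he⟩ := Finite.exists_min fun e : ι × ι => X e.1 e.2
  exact ⟨X e.1 e.2, h _ _, fun i j => he (i, j)⟩

/-- The lower bound persists for larger exponents, since each row of `W ^ L` is then a convex
combination of rows of `W ^ p`. -/
theorem exists_pos_le_pow_apply (hW : W ∈ doublyStochastic ℝ (Fin N)) {p : ℕ}
    (hp : ∀ i j, 0 < (W ^ p) i j) : ∃ a > 0, ∀ L, p ≤ L → ∀ i j, a ≤ (W ^ L) i j := by
  obtain ⟨a, ha, hle⟩ := exists_pos_le_apply hp
  refine ⟨a, ha, fun L hL i j => ?_⟩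
  obtain ⟨k, rfl⟩ := Nat.exists_eq_add_of_le' hL
  rw [pow_add, Matrix.mul_apply]
  calc a = ∑ l, (W ^ k) i l * a := by
        rw [← Finset.sum_mul, sum_row_of_mem_doublyStochastic (pow_mem hW k), one_mul]
    _ ≤ ∑ l, (W ^ k) i l * (W ^ p) l j := Finset.sum_le_sum fun l _ =>
        mul_le_mul_of_nonneg_left (hle l j) (nonneg_of_mem_doublyStochastic (pow_mem hW k))

/-- One block of `p` fusion steps contracts the distance to consensus: since the columns of
`W ^ L - 1 / N` sum to zero, `a` may be subtracted from every entry of `W ^ p` in the product. -/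
theorem abs_pow_add_sub_le (hW : W ∈ doublyStochastic ℝ (Fin N)) {p : ℕ} {a : ℝ}
    (ha : ∀ i j, a ≤ (W ^ p) i j) {L : ℕ} {c : ℝ}
    (hc : ∀ i j, |(N : ℝ) * (W ^ L) i j - 1| ≤ c) (i j : Fin N) :
    |(N : ℝ) * (W ^ (p + L)) i j - 1| ≤ (1 - N * a) * c := by
  have hrow : ∑ l, (W ^ p) i l = 1 := sum_row_of_mem_doublyStochastic (pow_mem hW p) i
  have hcol : ∑ l, (W ^ L) l j = 1 := sum_col_of_mem_doublyStochastic (pow_mem hW L) j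
  have hzero : ∑ l, ((N : ℝ) * (W ^ L) l j - 1) = 0 := by
    rw [Finset.sum_sub_distrib, ← Finset.mul_sum, hcol]
    simp
  have hkey : (N : ℝ) * (W ^ (p + L)) i j - 1
      = ∑ l, ((W ^ p) i l - a) * ((N : ℝ) * (W ^ L) l j - 1) := by
    have h1 : ∑ l, (W ^ p) i l * ((N : ℝ) * (W ^ L) l j - 1)
        = (N : ℝ) * (W ^ (p + L)) i j - 1 := by
      rw [pow_add, Matrix.mul_apply, Finset.mul_sum]
      conv_rhs => rw [← hrow]
      rw [← Finset.sum_sub_distrib]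
      exact Finset.sum_congr rfl fun l _ => by ring
    simp only [sub_mul (_ : ℝ) a]
    rw [Finset.sum_sub_distrib, ← Finset.mul_sum, hzero, mul_zero, sub_zero, h1]
  rw [hkey]
  calc |∑ l, ((W ^ p) i l - a) * ((N : ℝ) * (W ^ L) l j - 1)|
      ≤ ∑ l, |((W ^ p) i l - a) * ((N : ℝ) * (W ^ L) l j - 1)| := Finset.abs_sum_le_sum_abs _ _
    _ ≤ ∑ l, ((W ^ p) i l - a) * c := Finset.sum_le_sum fun l _ => by
        rw [abs_mul, abs_of_nonneg (sub_nonneg.2 (ha i l))]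
        exact mul_le_mul_of_nonneg_left (hc l j) (sub_nonneg.2 (ha i l))
    _ = (1 - N * a) * c := by
        rw [← Finset.sum_mul, Finset.sum_sub_distrib, hrow]
        simp

/-- The entries of the powers of a doubly stochastic matrix with some entrywise positive power
converge geometrically to `1 / N`. -/
theorem exists_geometric_bound (hW : W ∈ doublyStochastic ℝ (Fin N)) {p : ℕ} (hp : 0 < p)
    (hpos : ∀ i j, 0 < (W ^ p) i j) :
    ∃ M q : ℝ, 0 < M ∧ 0 < q ∧ q < 1 ∧
      ∀ L i j, |(N : ℝ) * (W ^ L) i j - 1| ≤ M * q ^ L := by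
  rcases Nat.eq_zero_or_pos N with rfl | hN
  · exact ⟨1, 1 / 2, one_pos, by norm_num, by norm_num, fun L i => i.elim0⟩
  obtain ⟨a, ha, hle⟩ := exists_pos_le_apply hpos
  have hN1 : (1 : ℝ) ≤ N := by exact_mod_cast hN
  have hp1 : (1 : ℝ) ≤ p := by exact_mod_cast hp
  -- Bernoulli's inequality makes this `q` a substitute for a `p`-th root of `1 - N * a`
  set h : ℝ := min (N * a) (1 / 2) / p with hh
  have hh0 : 0 < h := by positivity
  have hh1 : h ≤ 1 / 2 := (div_le_self (by positivity) hp1).trans (min_le_right _ _)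
  have hq0 : 0 < 1 - h := by linarith
  have hcontr : 1 - N * a ≤ (1 - h) ^ p := by
    have hb := one_add_mul_le_pow (a := -h) (by linarith) p
    have hph : (p : ℝ) * h = min (N * a) (1 / 2) := by
      rw [hh, mul_div_cancel₀ _ (by positivity)]
    have := min_le_left ((N : ℝ) * a) (1 / 2)
    calc 1 - N * a ≤ 1 + p * (-h) := by linarith
      _ ≤ (1 + -h) ^ p := hb
      _ = (1 - h) ^ p := by rw [← sub_eq_add_neg]
  refine ⟨N / (1 - h) ^ p, 1 - h, by positivity, hq0, by linarith, fun L => ?_⟩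
  induction L using Nat.strong_induction_on with
  | _ L ih =>
    intro i j
    rcases lt_or_ge L p with hL | hL
    · have h0 : 0 ≤ (W ^ L) i j := nonneg_of_mem_doublyStochastic (pow_mem hW L)
      have h1 : (W ^ L) i j ≤ 1 := le_one_of_mem_doublyStochastic (pow_mem hW L)
      have h2 : (1 - h) ^ p ≤ (1 - h) ^ L :=
        pow_le_pow_of_le_one hq0.le (by linarith) hL.le
      calc |(N : ℝ) * (W ^ L) i j - 1| ≤ N := by
            rw [abs_le]
            constructor <;> nlinarith
        _ = N / (1 - h) ^ p * (1 - h) ^ p := by field_simp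
        _ ≤ N / (1 - h) ^ p * (1 - h) ^ L := by gcongr
    · obtain ⟨k, rfl⟩ := Nat.exists_eq_add_of_le hL
      refine (abs_pow_add_sub_le hW hle (ih k (by omega)) i j).trans ?_
      calc (1 - N * a) * (N / (1 - h) ^ p * (1 - h) ^ k)
          ≤ (1 - h) ^ p * (N / (1 - h) ^ p * (1 - h) ^ k) := by gcongr
        _ = N / (1 - h) ^ p * (1 - h) ^ (p + k) := by rw [pow_add]; ring

end Consensus

/-! ### Comparison of the steady-state covariances -/

section Comparison

variable {n : ℕ} {ι : Type*} [Fintype ι] [DecidableEq ι]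
  {A : Matrix (Fin n) (Fin n) ℝ} {C : Matrix ι (Fin n) ℝ} {Q : Matrix (Fin n) (Fin n) ℝ}
  {R R₀ Rbar : Matrix ι ι ℝ} {P P₀ Pt : Matrix (Fin n) (Fin n) ℝ}

theorem IsDARESolution.existsUnique_isDLESolution (hQ : Q.PosDef) (hR : R.PosDef)
    (h : IsDARESolution A C Q R P) : ∃! Pt, IsDLESolution A C Q R Rbar P Pt := by
  have := existsUnique_lyapunov (h.tendsto_feedback_pow hQ hR)
    (Q + gain A C R P * Rbar * (gain A C R P)ᵀ)
  simp only [← add_assoc] at this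
  exact this

/-- A relative bound on the error in the noise covariance passes to the error covariance; it is
used with `s = 1` and `s = -1`. The gain term `K R Kᵀ` is part of `P - F P Fᵀ`, so the difference
of the two Lyapunov equations is dominated by `δ` times the equation for `P`. -/
theorem IsDARESolution.smul_add_smul_sub_nonneg (hQ : Q.PosDef) (hR : R.PosDef)
    (h : IsDARESolution A C Q R P) (ht : IsDLESolution A C Q R Rbar P Pt) {δ s : ℝ} (hδ : 0 ≤ δ)
    (hRbar : 0 ≤ δ • R + s • (Rbar - R)) : 0 ≤ δ • P + s • (Pt - P) := by
  have h1 := h.closedLoop_eq hR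
  unfold closedLoop at h1
  have h2 : (A - gain A C R P * C) * Pt * (A - gain A C R P * C)ᵀ + Q +
      gain A C R P * Rbar * (gain A C R P)ᵀ = Pt := ht.symm
  refine nonneg_of_conj_le (h.tendsto_feedback_pow hQ hR) ?_
  generalize gain A C R P = K at h1 h2 ⊢
  generalize A - K * C = F at h1 h2 ⊢
  have hkey : δ • P + s • (Pt - P) - F * (δ • P + s • (Pt - P)) * Fᵀ =
      δ • Q + K * (δ • R + s • (Rbar - R)) * Kᵀ := by
    have e1 : P - F * P * Fᵀ = Q + K * R * Kᵀ := by
      rw [sub_eq_iff_eq_add']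
      conv_lhs => rw [← h1]
      abel
    have e2 : Pt - F * Pt * Fᵀ = Q + K * Rbar * Kᵀ := by
      rw [sub_eq_iff_eq_add']
      conv_lhs => rw [← h2]
      abel
    calc δ • P + s • (Pt - P) - F * (δ • P + s • (Pt - P)) * Fᵀ
        = δ • (P - F * P * Fᵀ) + s • ((Pt - F * Pt * Fᵀ) - (P - F * P * Fᵀ)) := by
          simp only [Matrix.mul_add, Matrix.add_mul, Matrix.mul_sub, Matrix.sub_mul,
            Matrix.mul_smul, Matrix.smul_mul]
          module
      _ = δ • Q + K * (δ • R + s • (Rbar - R)) * Kᵀ := by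
          rw [e1, e2]
          simp only [Matrix.mul_add, Matrix.add_mul, Matrix.mul_sub, Matrix.sub_mul,
            Matrix.mul_smul, Matrix.smul_mul]
          module
  rw [← sub_nonneg, hkey]
  exact add_nonneg (smul_nonneg hδ hQ.posSemidef.nonneg) (conj_nonneg K hRbar)

/-- Comparison with the filter that is optimal for another noise covariance `R₀`. -/
theorem IsDARESolution.le_smul (hQ : Q.PosDef) (hR : R.PosDef) (hR₀ : R₀.PosDef)
    (h : IsDARESolution A C Q R P) (h₀ : IsDARESolution A C Q R₀ P₀) {c : ℝ} (hc : 1 ≤ c)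
    (hle : R ≤ c • R₀) : P ≤ c • P₀ := by
  refine h.le_of_closedLoop_le hR (h₀.tendsto_feedback_pow hQ hR₀) ?_
  conv_rhs => rw [← h₀.closedLoop_eq hR₀]
  unfold closedLoop
  rw [smul_add, smul_add]
  have h1 : Q ≤ c • Q := by
    simpa using smul_le_smul_of_nonneg_right hc hQ.posSemidef.nonneg
  have h2 := conj_mono (gain A C R₀ P₀) hle
  rw [Matrix.mul_smul, Matrix.smul_mul] at h2
  rw [Matrix.mul_smul, Matrix.smul_mul]
  exact add_le_add (add_le_add le_rfl h1) h2

end Comparison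

theorem abs_apply_le_of_neg_le_of_le {ι : Type*} [Fintype ι] [DecidableEq ι] {D S : Matrix ι ι ℝ}
    (hS : 0 ≤ S) (h1 : 0 ≤ S + D) (h2 : 0 ≤ S - D) (i j : ι) :
    |D i j| ≤ (S i i + S j j) / 2 := by
  have hsymm : ∀ {X : Matrix ι ι ℝ}, 0 ≤ X → X j i = X i j := fun hX =>
    congrFun (congrFun (transpose_eq_of_nonneg hX) i) j
  have s1 := hsymm hS
  have s2 := hsymm h1
  have q1 := quadForm_nonneg h1 (Pi.single i 1 + Pi.single j 1)
  have q2 := quadForm_nonneg h1 (Pi.single i 1 - Pi.single j 1)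
  have q3 := quadForm_nonneg h2 (Pi.single i 1 + Pi.single j 1)
  have q4 := quadForm_nonneg h2 (Pi.single i 1 - Pi.single j 1)
  simp only [Matrix.mulVec_add, Matrix.mulVec_sub, dotProduct_add, dotProduct_sub, add_dotProduct,
    sub_dotProduct, Matrix.mulVec_single_one, single_one_dotProduct, Matrix.col_apply,
    Matrix.add_apply, Matrix.sub_apply] at q1 q2 q3 q4 s2
  rw [abs_le]
  constructor <;> linarith

theorem norm_le_sum_abs_apply {ι : Type*} [Fintype ι] [DecidableEq ι] (D : Matrix ι ι ℝ) :
    ‖D‖ ≤ ∑ i, ∑ j, |D i j| * ‖Matrix.single i j (1 : ℝ)‖ := by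
  conv_lhs => rw [Matrix.matrix_eq_sum_single D]
  refine (norm_sum_le _ _).trans (Finset.sum_le_sum fun i _ =>
    (norm_sum_le _ _).trans (Finset.sum_le_sum fun j _ => ?_))
  rw [show Matrix.single i j (D i j) = D i j • Matrix.single i j (1 : ℝ) by simp, norm_smul,
    Real.norm_eq_abs]

section Blocks

variable {N : ℕ} {m : Fin N → ℕ} {R : ∀ j : Fin N, Matrix (Fin (m j)) (Fin (m j)) ℝ}

theorem blockDiagonal_smul_isHermitian (hR : ∀ j, (R j).PosDef) (c : Fin N → ℝ) :
    (Matrix.blockDiagonal' fun j => c j • R j).IsHermitian := by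
  rw [Matrix.IsHermitian, Matrix.blockDiagonal'_conjTranspose]
  congr 1
  ext1 j
  rw [Matrix.conjTranspose_smul, (hR j).1.eq, star_trivial]

theorem quadForm_blockDiagonal_smul (c : Fin N → ℝ) (x : (Σ j : Fin N, Fin (m j)) → ℝ) :
    x ⬝ᵥ (Matrix.blockDiagonal' fun j => c j • R j) *ᵥ x =
      ∑ j, c j * ((fun r => x ⟨j, r⟩) ⬝ᵥ R j *ᵥ fun r => x ⟨j, r⟩) := by
  simp only [dotProduct, Matrix.mulVec, Fintype.sum_sigma, Finset.mul_sum]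
  refine Finset.sum_congr rfl fun j _ => Finset.sum_congr rfl fun r _ => ?_
  rw [Finset.sum_eq_single j]
  · refine Finset.sum_congr rfl fun t _ => ?_
    rw [Matrix.blockDiagonal'_apply_eq, Matrix.smul_apply, smul_eq_mul]
    ring
  · intro k _ hk
    refine Finset.sum_eq_zero fun t _ => ?_
    rw [Matrix.blockDiagonal'_apply_ne _ _ _ hk.symm]
    ring
  · simp

theorem blockDiagonal_smul_posSemidef (hR : ∀ j, (R j).PosDef) {c : Fin N → ℝ}
    (hc : ∀ j, 0 ≤ c j) : (Matrix.blockDiagonal' fun j => c j • R j).PosSemidef := by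
  refine Matrix.PosSemidef.of_dotProduct_mulVec_nonneg (blockDiagonal_smul_isHermitian hR c)
    fun x => ?_
  rw [star_trivial, quadForm_blockDiagonal_smul]
  exact Finset.sum_nonneg fun j _ =>
    mul_nonneg (hc j) (quadForm_nonneg (hR j).posSemidef.nonneg _)

theorem blockDiagonal_smul_posDef (hR : ∀ j, (R j).PosDef) {c : Fin N → ℝ}
    (hc : ∀ j, 0 < c j) : (Matrix.blockDiagonal' fun j => c j • R j).PosDef := by
  refine Matrix.PosDef.of_dotProduct_mulVec_pos (blockDiagonal_smul_isHermitian hR c)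
    fun x hx => ?_
  obtain ⟨⟨j, r⟩, hjr⟩ := Function.ne_iff.1 hx
  have hj : (fun r => x ⟨j, r⟩) ≠ 0 := Function.ne_iff.2 ⟨r, hjr⟩
  rw [star_trivial, quadForm_blockDiagonal_smul]
  exact Finset.sum_pos' (fun k _ =>
    mul_nonneg (hc k).le (quadForm_nonneg (hR k).posSemidef.nonneg _))
    ⟨j, Finset.mem_univ _, mul_pos (hc j) ((hR j).dotProduct_mulVec_pos hj)⟩

theorem blockDiagonal_smul_mono (hR : ∀ j, (R j).PosDef) {c c' : Fin N → ℝ}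
    (h : ∀ j, c j ≤ c' j) : (Matrix.blockDiagonal' fun j => c j • R j) ≤
      Matrix.blockDiagonal' fun j => c' j • R j := by
  rw [Matrix.le_iff, ← Matrix.blockDiagonal'_sub]
  simp only [Pi.sub_def, ← sub_smul]
  exact blockDiagonal_smul_posSemidef hR fun j => sub_nonneg.2 (h j)

variable {n : ℕ} {W : Matrix (Fin N) (Fin N) ℝ}

theorem modC_eq_stack (C : ∀ j : Fin N, Matrix (Fin (m j)) (Fin n) ℝ) {i : Fin N} {L : ℕ}
    (hpos : ∀ j, 0 < (W ^ L) i j) : modC W C i L = stack C := by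
  simp [modC, Real.sign_of_pos (hpos _)]

theorem barR_eq_blockDiagonal (R : ∀ j : Fin N, Matrix (Fin (m j)) (Fin (m j)) ℝ) {i : Fin N}
    {L : ℕ} (hpos : ∀ j, 0 < (W ^ L) i j) : barR W R i L = Matrix.blockDiagonal' R := by
  simp [barR, Real.sign_of_pos (hpos _)]

theorem weight_pos {i : Fin N} {L : ℕ} (hpos : ∀ j, 0 < (W ^ L) i j) (j : Fin N) :
    0 < 1 / ((N : ℝ) * (W ^ L) i j) := by
  have hN : (0 : ℝ) < N := by exact_mod_cast Fin.pos i
  have := hpos j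
  positivity

theorem modR_posDef (hR : ∀ j, (R j).PosDef) {i : Fin N} {L : ℕ}
    (hpos : ∀ j, 0 < (W ^ L) i j) : (modR W R i L).PosDef :=
  blockDiagonal_smul_posDef hR (weight_pos hpos)

theorem modR_le_smul (hR : ∀ j, (R j).PosDef) {i : Fin N} {L : ℕ} {a : ℝ} (ha : 0 < a)
    (hle : ∀ j, a ≤ (W ^ L) i j) :
    modR W R i L ≤ max 1 (1 / (N * a)) • Matrix.blockDiagonal' R := by
  have hN : (0 : ℝ) < N := by exact_mod_cast Fin.pos i
  rw [← Matrix.blockDiagonal'_smul]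
  refine blockDiagonal_smul_mono (c' := fun _ => max 1 (1 / (N * a))) hR fun j =>
    le_trans ?_ (le_max_right _ _)
  have := hle j
  gcongr

theorem smul_modR_add_smul_sub_nonneg (hR : ∀ j, (R j).PosDef) {i : Fin N} {L : ℕ}
    (hpos : ∀ j, 0 < (W ^ L) i j) {δ s : ℝ} (hδ : ∀ j, |(N : ℝ) * (W ^ L) i j - 1| ≤ δ)
    (hs : |s| = 1) :
    0 ≤ δ • modR W R i L + s • (Matrix.blockDiagonal' R - modR W R i L) := by
  have hN : (0 : ℝ) < N := by exact_mod_cast Fin.pos i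
  have hkey : δ • modR W R i L + s • (Matrix.blockDiagonal' R - modR W R i L) =
      Matrix.blockDiagonal' fun j =>
        (1 / ((N : ℝ) * (W ^ L) i j) * (δ + s * ((N : ℝ) * (W ^ L) i j - 1))) • R j := by
    rw [modR, ← Matrix.blockDiagonal'_smul, ← Matrix.blockDiagonal'_sub,
      ← Matrix.blockDiagonal'_smul, ← Matrix.blockDiagonal'_add]
    congr 1
    ext1 j
    have hj := (hpos j).ne'
    have hw : 1 / ((N : ℝ) * (W ^ L) i j) * ((N : ℝ) * (W ^ L) i j) = 1 :=
      one_div_mul_cancel (mul_pos hN (hpos j)).ne'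
    have : 1 / ((N : ℝ) * (W ^ L) i j) * (δ + s * ((N : ℝ) * (W ^ L) i j - 1)) =
        δ * (1 / ((N : ℝ) * (W ^ L) i j)) + s * (1 - 1 / ((N : ℝ) * (W ^ L) i j)) := by
      linear_combination s * hw
    rw [this]
    simp only [Pi.add_apply, Pi.smul_apply, Pi.sub_apply]
    module
  rw [hkey]
  refine (blockDiagonal_smul_posSemidef hR fun j => ?_).nonneg
  refine mul_nonneg (weight_pos hpos j).le ?_
  have h1 : |s * ((N : ℝ) * (W ^ L) i j - 1)| ≤ δ := by
    rw [abs_mul, hs, one_mul]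
    exact hδ j
  linarith [neg_le_of_abs_le h1]

/-- The decay estimate. Its constant combines the consensus rate with the size of the solution `P₀`
of the Riccati equation for the true noise covariance. -/
theorem exists_decay_bound (hW : W ∈ doublyStochastic ℝ (Fin N)) (hdiag : ∀ i, 0 < W i i)
    (hconn : StronglyConnected W) {A : Matrix (Fin n) (Fin n) ℝ}
    {C : ∀ j : Fin N, Matrix (Fin (m j)) (Fin n) ℝ} {Q : Matrix (Fin n) (Fin n) ℝ}
    (hQ : Q.PosDef) (hR : ∀ j, (R j).PosDef) (hobs : Observable A (stack C)) :
    ∃ M₂ q₂ : ℝ, 0 < M₂ ∧ 0 < q₂ ∧ q₂ < 1 ∧ ∀ (i : Fin N) (L : ℕ), diameter W ≤ L →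
      ∀ P Pt : Matrix (Fin n) (Fin n) ℝ,
        IsDARESolution A (modC W C i L) Q (modR W R i L) P →
        IsDLESolution A (modC W C i L) Q (modR W R i L) (barR W R i L) P Pt →
        ‖Pt - P‖ ≤ M₂ * q₂ ^ L := by
  have hpos : ∀ L, diameter W ≤ L → ∀ i j, 0 < (W ^ L) i j :=
    fun L hL => pow_apply_pos_of_diameter_le hW hdiag hconn hL
  -- the optimal filter for the true noise covariance bounds all the others
  have hR₀ : (Matrix.blockDiagonal' R).PosDef := by
    simpa using blockDiagonal_smul_posDef hR (c := fun _ => 1) fun _ => one_pos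
  obtain ⟨P₀, hP₀⟩ := exists_isDARESolution (A := A) hQ hR₀ hobs
  obtain ⟨a, ha, hle⟩ := exists_pos_le_pow_apply hW (hpos _ le_rfl)
  -- the exponent is shifted by one since the diameter is `0` when `N = 1`
  obtain ⟨M, q, hM, hq0, hq1, hbound⟩ := exists_geometric_bound hW
    (Nat.succ_pos (diameter W)) (hpos _ (Nat.le_succ _))
  set c : ℝ := max 1 (1 / (N * a)) with hc
  have hc1 : 1 ≤ c := le_max_left _ _
  set B : ℝ := ∑ i, ∑ j, c * ((P₀ i i + P₀ j j) / 2) *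
    ‖Matrix.single i j (1 : ℝ)‖ with hB
  have hdiag₀ : ∀ i, 0 ≤ P₀ i i := fun i => hP₀.1.diag_nonneg
  have hB0 : 0 ≤ B := Finset.sum_nonneg fun i _ => Finset.sum_nonneg fun j _ => by
    have := hdiag₀ i
    have := hdiag₀ j
    positivity
  -- `B` vanishes for `n = 0`, hence the extra `1`
  refine ⟨M * (B + 1), q, by positivity, hq0, hq1, fun i L hL P Pt hP hPt => ?_⟩
  rw [modC_eq_stack C (hpos L hL i)] at hP hPt
  rw [barR_eq_blockDiagonal R (hpos L hL i)] at hPt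
  have hR' := modR_posDef hR (hpos L hL i)
  set δ : ℝ := M * q ^ L with hδ
  have hδ0 : 0 ≤ δ := by positivity
  have hPle : P ≤ c • P₀ := hP.le_smul hQ hR' hR₀ hP₀ hc1 (modR_le_smul hR ha (hle L hL i))
  have hδP : δ • P ≤ (δ * c) • P₀ := by
    rw [mul_smul δ c P₀]
    exact smul_le_smul_of_nonneg_left hPle hδ0
  have hnear : ∀ s : ℝ, |s| = 1 → 0 ≤ δ • P + s • (Pt - P) := fun s hs =>
    hP.smul_add_smul_sub_nonneg hQ hR' hPt hδ0
      (smul_modR_add_smul_sub_nonneg hR (hpos L hL i) (hbound L i) hs)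
  have hadd : 0 ≤ (δ * c) • P₀ + (Pt - P) := by
    refine (hnear 1 (by simp)).trans ?_
    rw [one_smul]
    gcongr
  have hsub : 0 ≤ (δ * c) • P₀ - (Pt - P) := by
    refine (hnear (-1) (by simp)).trans ?_
    rw [neg_one_smul, ← sub_eq_add_neg]
    gcongr
  have hentry := abs_apply_le_of_neg_le_of_le
    (smul_nonneg (by positivity) hP₀.nonneg) hadd hsub
  calc ‖Pt - P‖ ≤ ∑ i, ∑ j, |(Pt - P) i j| * ‖Matrix.single i j (1 : ℝ)‖ :=
        norm_le_sum_abs_apply _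
    _ ≤ ∑ i, ∑ j, δ * (c * ((P₀ i i + P₀ j j) / 2) * ‖Matrix.single i j (1 : ℝ)‖) := by
        refine Finset.sum_le_sum fun k _ => Finset.sum_le_sum fun l _ => ?_
        rw [← mul_assoc]
        refine mul_le_mul_of_nonneg_right ((hentry k l).trans_eq ?_) (norm_nonneg _)
        simp only [Matrix.smul_apply, smul_eq_mul]
        ring
    _ = δ * B := by simp only [hB, Finset.mul_sum]
    _ ≤ M * (B + 1) * q ^ L := by
        rw [hδ]
        nlinarith [mul_pos hM (pow_pos hq0 L)]

end Blocks

end CMDF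

end

theorem theorem3 {N n : ℕ} {m : Fin N → ℕ}
    (W : Matrix (Fin N) (Fin N) ℝ)
    (hW : W ∈ doublyStochastic ℝ (Fin N))
    (hdiag : ∀ i, 0 < W i i)
    (hconn : CMDF.StronglyConnected W)
    (A : Matrix (Fin n) (Fin n) ℝ)
    (C : ∀ j : Fin N, Matrix (Fin (m j)) (Fin n) ℝ)
    (Q : Matrix (Fin n) (Fin n) ℝ)
    (R : ∀ j : Fin N, Matrix (Fin (m j)) (Fin (m j)) ℝ)
    (hQ : Q.PosDef) (hR : ∀ j, (R j).PosDef)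
    (hobs : CMDF.Observable A (CMDF.stack C)) :
    -- the two steady-state matrices are well defined
    (∀ (i : Fin N) (L : ℕ), CMDF.diameter W ≤ L →
      ∃! P : Matrix (Fin n) (Fin n) ℝ,
        CMDF.IsDARESolution A (CMDF.modC W C i L) Q (CMDF.modR W R i L) P) ∧
    (∀ (i : Fin N) (L : ℕ), CMDF.diameter W ≤ L →
      ∀ P : Matrix (Fin n) (Fin n) ℝ,
        CMDF.IsDARESolution A (CMDF.modC W C i L) Q (CMDF.modR W R i L) P →
        ∃! Pt : Matrix (Fin n) (Fin n) ℝ,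
          CMDF.IsDLESolution A (CMDF.modC W C i L) Q (CMDF.modR W R i L) (CMDF.barR W R i L)
            P Pt) ∧
    -- and their distance decays exponentially in the number of fusion steps
    ∃ M₂ q₂ : ℝ, 0 < M₂ ∧ 0 < q₂ ∧ q₂ < 1 ∧
      ∀ (i : Fin N) (L : ℕ), CMDF.diameter W ≤ L →
        ∀ P Pt : Matrix (Fin n) (Fin n) ℝ,
          CMDF.IsDARESolution A (CMDF.modC W C i L) Q (CMDF.modR W R i L) P →
          CMDF.IsDLESolution A (CMDF.modC W C i L) Q (CMDF.modR W R i L) (CMDF.barR W R i L)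
            P Pt →
          ‖Pt - P‖ ≤ M₂ * q₂ ^ L := by
  have hpos : ∀ L, CMDF.diameter W ≤ L → ∀ i j, 0 < (W ^ L) i j :=
    fun L hL => CMDF.pow_apply_pos_of_diameter_le hW hdiag hconn hL
  refine ⟨fun i L hL => ?_, fun i L hL P hP => ?_,
    CMDF.exists_decay_bound hW hdiag hconn hQ hR hobs⟩
  · rw [CMDF.modC_eq_stack C (hpos L hL i)]
    have hR' := CMDF.modR_posDef hR (hpos L hL i)
    obtain ⟨P, hP⟩ := CMDF.exists_isDARESolution hQ hR' hobs
    exact ⟨P, hP, fun P' hP' => hP'.unique hQ hR' hP⟩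
  · exact hP.existsUnique_isDLESolution hQ (CMDF.modR_posDef hR (hpos L hL i))
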